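/- A \emph{smooth regular surface} is a connected set $\Sigma\subset\mathbb{R}^3$ such that every point of $\Sigma$ has a neighborhood in $\Sigma$ that, in some Cartesian coordinate system $(x,y,z)$ of $\mathbb{R}^3$, is the graph $z=h(x,y)$ of a $C^\infty$ function $h$ defined on an open subset of the $(x,y)$-plane. A map $f\colon\Sigma\to\Sigma^{*}$ between smooth regular surfaces is called an \emph{intrinsic isometry} if it is bijective, smooth (that is, $f\circ s$ is $C^\infty$ for every chart $s$ of $\Sigma$), and length-preserving: for every curve $\gamma$ in $\Sigma$ the curve $f\circ\gamma$ has the same length as $\gamma$. For a point $p$ of a smooth regular surface $\Sigma$, choose Cartesian coordinates with origin at $p$ whose $(x,y)$-plane is the tangent plane of $\Sigma$ at $p$, and write $\Sigma$ near $p$ as a graph $z=h(x,y)$. The \emph{principal curvatures} $k_1\le k_2$ of $\Sigma$ at $p$ are the eigenvalues of the Hessian matrix of $h$ at $(0,0)$. The \emph{Gauss curvature} $K(p)_\Sigma=k_1\cdot k_2$ is their product; it does not depend on the choice of the coordinates. \textbf{Theorem (Theorema Egregium).} Suppose $f\colon\Sigma\to\Sigma^{*}$ is an intrinsic isometry between two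 smooth regular surfaces in $\mathbb{R}^3$, and let $p\in\Sigma$. Then \[K(p)_{\Sigma}=K(f(p))_{\Sigma^{*}}.\] -/

import Mathlib

open scoped ContDiff

namespace Egregium

/-- The Euclidean space `ℝ³`. -/
abbrev E3 : Type := EuclideanSpace ℝ (Fin 3)

/-! ### Smooth regular surfaces -/

/-- The first two coordinates `(x, y)` of the point `q` in the Cartesian coordinate system with
origin `o` and axes directed by the orthonormal basis `b`. -/
noncomputable def coordXY (o : E3) (b : OrthonormalBasis (Fin 3) ℝ E3) (q : E3) : ℝ × ℝ :=
  (b.repr (q - o) 0, b.repr (q - o) 1)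

/-- The third coordinate `z` of the point `q` in the Cartesian coordinate system with
origin `o` and axes directed by the orthonormal basis `b`. -/
noncomputable def coordZ (o : E3) (b : OrthonormalBasis (Fin 3) ℝ E3) (q : E3) : ℝ :=
  b.repr (q - o) 2

/-- In the Cartesian coordinates `(x, y, z)` with origin `o` and axes `b`, a neighborhood of `p`
in `S` is the graph `z = h (x, y)` of a function `h` that is smooth on the open set `Ω`. -/
def IsLocalGraphAt (S : Set E3) (p o : E3) (b : OrthonormalBasis (Fin 3) ℝ E3)
    (Ω : Set (ℝ × ℝ)) (h : ℝ × ℝ → ℝ) : Prop :=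
  IsOpen Ω ∧ ContDiffOn ℝ ∞ h Ω ∧
    ∃ U : Set E3, IsOpen U ∧ p ∈ U ∧
      U ∩ S = {q | coordXY o b q ∈ Ω ∧ coordZ o b q = h (coordXY o b q)}

/-- A smooth regular (embedded) surface (without boundary) in `ℝ³`: a connected set that in
a neighborhood of each of its points is the graph of a smooth function in suitable coordinates. -/
def IsSmoothSurface (S : Set E3) : Prop :=
  IsConnected S ∧ ∀ p ∈ S, ∃ (o : E3) (b : OrthonormalBasis (Fin 3) ℝ E3)
    (Ω : Set (ℝ × ℝ)) (h : ℝ × ℝ → ℝ), IsLocalGraphAt S p o b Ω h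

/-! ### Smooth maps and intrinsic isometries -/

/-- The map `s`, considered on the open set `U` of the plane, is a chart of `S`: a smooth regular
embedding whose image is an open subset of `S`. -/
structure IsChart (S : Set E3) (U : Set (ℝ × ℝ)) (s : ℝ × ℝ → E3) : Prop where
  isOpen : IsOpen U
  smooth : ContDiffOn ℝ ∞ s U
  regular : ∀ q ∈ U, LinearIndependent ℝ ![fderiv ℝ s q (1, 0), fderiv ℝ s q (0, 1)]
  embedding : Topology.IsEmbedding (U.domRestrict s)
  image : ∃ W : Set E3, IsOpen W ∧ s '' U = W ∩ S

/-- The restriction of `f` to the surface `S` is smooth: it is smooth in every chart of `S`. -/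
def IsSmoothMapOn (S : Set E3) (f : E3 → E3) : Prop :=
  ∀ (U : Set (ℝ × ℝ)) (s : ℝ × ℝ → E3), IsChart S U s → ContDiffOn ℝ ∞ (f ∘ s) U

/-- The length (in `[0, ∞]`) of the curve `γ` parametrized by the interval `I`: the least upper
bound of the lengths of inscribed polygonal lines. -/
noncomputable def curveLength (γ : ℝ → E3) (I : Set ℝ) : ENNReal := eVariationOn γ I

/-- `f` preserves the length of every (continuous) curve in `S`. The parameter interval may be
open, closed or semi-open; closed curves are included as loops. -/
def IsLengthPreservingOn (S : Set E3) (f : E3 → E3) : Prop :=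
  ∀ (I : Set ℝ) (γ : ℝ → E3), I.OrdConnected → ContinuousOn γ I → Set.MapsTo γ I S →
    curveLength (f ∘ γ) I = curveLength γ I

/-- The restriction of `f` to `S` is an intrinsic isometry `S → T`: a smooth length-preserving
bijection. The values of `f` outside of `S` play no role. -/
structure IsIntrinsicIsometry (S T : Set E3) (f : E3 → E3) : Prop where
  bijOn : Set.BijOn f S T
  smooth : IsSmoothMapOn S f
  lengthPreserving : IsLengthPreservingOn S f

/-! ### Gauss curvature -/

/-- The set of tangent vectors of `S` at `p`: the velocity vectors at `p` of smooth curves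
that run in `S`. For a smooth surface it is a two-dimensional linear subspace. -/
def tangentVectors (S : Set E3) (p : E3) : Set E3 :=
  {w | ∃ (γ : ℝ → E3) (ε : ℝ), 0 < ε ∧ ContDiffOn ℝ ∞ γ (Set.Ioo (-ε) ε) ∧
    Set.MapsTo γ (Set.Ioo (-ε) ε) S ∧ γ 0 = p ∧ HasDerivAt γ w 0}

/-- Tangent-normal coordinates of `S` at `p`: the Cartesian coordinates with origin at `p` and
axes `b` whose `(x, y)`-plane is the tangent plane of `S` at `p`; near `p` the surface is
the graph `z = h (x, y)` of the smooth function `h` on the open set `Ω`. -/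
structure IsTangentNormalAt (S : Set E3) (p : E3) (b : OrthonormalBasis (Fin 3) ℝ E3)
    (Ω : Set (ℝ × ℝ)) (h : ℝ × ℝ → ℝ) : Prop where
  tangent : tangentVectors S p = (Submodule.span ℝ {b 0, b 1} : Submodule ℝ E3)
  graph : IsLocalGraphAt S p p b Ω h

/-- The partial derivative `∂h/∂x`. -/
noncomputable def partialX (h : ℝ × ℝ → ℝ) : ℝ × ℝ → ℝ := fun q => fderiv ℝ h q (1, 0)

/-- The partial derivative `∂h/∂y`. -/
noncomputable def partialY (h : ℝ × ℝ → ℝ) : ℝ × ℝ → ℝ := fun q => fderiv ℝ h q (0, 1)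

/-- The Hessian matrix of `h` at `(0, 0)`. -/
noncomputable def hessianMatrix (h : ℝ × ℝ → ℝ) : Matrix (Fin 2) (Fin 2) ℝ :=
  !![partialX (partialX h) (0, 0), partialY (partialX h) (0, 0);
     partialX (partialY h) (0, 0), partialY (partialY h) (0, 0)]

/-- `k₁ ≤ k₂` are the principal curvatures of `S` at `p` (for one of the two choices of the unit
normal vector at `p`): the eigenvalues, with multiplicity, of the Hessian matrix of the function
that represents `S` in tangent-normal coordinates at `p`. -/
def IsPrincipalCurvatures (S : Set E3) (p : E3) (k₁ k₂ : ℝ) : Prop :=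
  k₁ ≤ k₂ ∧ ∃ (b : OrthonormalBasis (Fin 3) ℝ E3) (Ω : Set (ℝ × ℝ)) (h : ℝ × ℝ → ℝ),
    IsTangentNormalAt S p b Ω h ∧ (hessianMatrix h).charpoly.roots = {k₁, k₂}

/-- `K` is the Gauss curvature of `S` at `p`, the product of the principal curvatures. It is part
of the definition that `S` has principal curvatures at `p` and that their product does not depend
on the choice of the tangent-normal coordinates; so there is at most one such `K`. -/
def HasGaussCurvatureAt (S : Set E3) (p : E3) (K : ℝ) : Prop :=
  (∃ k₁ k₂ : ℝ, IsPrincipalCurvatures S p k₁ k₂) ∧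
    ∀ k₁ k₂ : ℝ, IsPrincipalCurvatures S p k₁ k₂ → k₁ * k₂ = K

end Egregium

/-! The proof isolates a curvature expression that depends on the metric alone and evaluates it in
tangent-normal coordinates. Preservation of lengths gives equal speeds (`norm_dirDeriv_comp_eq`).
Hence, by polarization, a graph parametrization `s` of the source and `r = f ∘ s` induce the same
metric.

Differentiating the metric once determines the products ⟨r_uv, r_w⟩, the Christoffel symbols of the
first kind. Differentiating these and cancelling the third derivatives determines ⟨r_vv, r_ww⟩ -
⟨r_vw, r_vw⟩ (`inner_sub_inner_eq_of_isometric`).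

At the origin of tangent-normal coordinates the second derivatives of `s` are normal, so the
expression is the Hessian determinant of `h`. The Christoffel symbols vanish there for `s`, hence
for `r`, so the second derivatives of `r` are normal to the target. They are given by the Hessian of
`h'` pulled back by a linear isometry of the tangent planes, whose determinant squares to 1. So the
two Hessian determinants agree (`det_hessianMatrix_eq`).

Tangent-normal coordinates exist by the inverse function theorem. Independence of their choice is
the same result applied to the identity map. -/

open scoped ContDiff

namespace Egregium

/-! ### Directional derivatives and metric invariants of a parametrization -/

section Calculus

variable {V F G : Type*} [NormedAddCommGroup V] [NormedSpace ℝ V]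
  [NormedAddCommGroup F] [NormedSpace ℝ F] [NormedAddCommGroup G] [InnerProductSpace ℝ G]

/-- The derivative of `g` in the constant direction `v`. -/
noncomputable def dirDeriv (v : V) (g : V → F) : V → F := fun q => fderiv ℝ g q v

theorem contDiffOn_dirDeriv {g : V → F} {Ω : Set V} (hΩ : IsOpen Ω) (hg : ContDiffOn ℝ ∞ g Ω)
    (v : V) : ContDiffOn ℝ ∞ (dirDeriv v g) Ω :=
  (hg.fderiv_of_isOpen hΩ (by simp)).clm_apply contDiffOn_const

theorem differentiableAt_of_contDiffOn {g : V → F} {Ω : Set V} (hΩ : IsOpen Ω)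
    (hg : ContDiffOn ℝ ∞ g Ω) {q : V} (hq : q ∈ Ω) : DifferentiableAt ℝ g q :=
  (hg.contDiffAt (hΩ.mem_nhds hq)).differentiableAt (by simp)

theorem dirDeriv_congr {g g' : V → F} {Ω : Set V} (hΩ : IsOpen Ω) (h : Set.EqOn g g' Ω) (v : V) :
    Set.EqOn (dirDeriv v g) (dirDeriv v g') Ω := fun q hq => by
  have : g =ᶠ[nhds q] g' := Filter.eventuallyEq_of_mem (hΩ.mem_nhds hq) h
  simp only [dirDeriv, this.fderiv_eq]

theorem dirDeriv_dirDeriv_eq {g : V → F} {Ω : Set V} (hΩ : IsOpen Ω) (hg : ContDiffOn ℝ ∞ g Ω)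
    (v w : V) {q : V} (hq : q ∈ Ω) :
    dirDeriv v (dirDeriv w g) q = fderiv ℝ (fderiv ℝ g) q v w := by
  have h := differentiableAt_of_contDiffOn hΩ (hg.fderiv_of_isOpen hΩ (m := ∞) (by simp)) hq
  unfold dirDeriv
  rw [fderiv_clm_apply h (differentiableAt_const w)]
  simp

theorem dirDeriv_comm {g : V → F} {Ω : Set V} (hΩ : IsOpen Ω) (hg : ContDiffOn ℝ ∞ g Ω)
    (v w : V) : Set.EqOn (dirDeriv v (dirDeriv w g)) (dirDeriv w (dirDeriv v g)) Ω := by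
  intro q hq
  rw [dirDeriv_dirDeriv_eq hΩ hg v w hq, dirDeriv_dirDeriv_eq hΩ hg w v hq]
  exact ((hg.contDiffAt (hΩ.mem_nhds hq)).isSymmSndFDerivAt
    (by rw [minSmoothness_of_isRCLikeNormedField]; exact ENat.LEInfty.out)) v w

theorem dirDeriv_inner {a c : V → G} {Ω : Set V} (hΩ : IsOpen Ω) (ha : ContDiffOn ℝ ∞ a Ω)
    (hc : ContDiffOn ℝ ∞ c Ω) (v : V) {q : V} (hq : q ∈ Ω) :
    dirDeriv v (fun x => inner ℝ (a x) (c x)) q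
      = inner ℝ (a q) (dirDeriv v c q) + inner ℝ (dirDeriv v a q) (c q) :=
  fderiv_inner_apply ℝ (differentiableAt_of_contDiffOn hΩ ha hq)
    (differentiableAt_of_contDiffOn hΩ hc hq) v

variable {r s : V → G} {Ω : Set V}

/-- The first-order consequence of the equality of two induced metrics. -/
theorem inner_dirDeriv_dirDeriv_eq_of_isometric (hΩ : IsOpen Ω) (hr : ContDiffOn ℝ ∞ r Ω)
    (hs : ContDiffOn ℝ ∞ s Ω)
    (h : ∀ v w : V, ∀ q ∈ Ω, inner ℝ (dirDeriv v r q) (dirDeriv w r q)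
      = inner ℝ (dirDeriv v s q) (dirDeriv w s q)) (u v w : V) {q : V} (hq : q ∈ Ω) :
    inner ℝ (dirDeriv u (dirDeriv v r) q) (dirDeriv w r q)
      = inner ℝ (dirDeriv u (dirDeriv v s) q) (dirDeriv w s q) := by
  -- Product rule applied to the equality of metrics, differentiated along `u`.
  have key : ∀ u v w : V,
      inner ℝ (dirDeriv v r q) (dirDeriv u (dirDeriv w r) q)
        + inner ℝ (dirDeriv u (dirDeriv v r) q) (dirDeriv w r q)
      = inner ℝ (dirDeriv v s q) (dirDeriv u (dirDeriv w s) q)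
        + inner ℝ (dirDeriv u (dirDeriv v s) q) (dirDeriv w s q) := fun u v w => by
    rw [← dirDeriv_inner hΩ (contDiffOn_dirDeriv hΩ hr v) (contDiffOn_dirDeriv hΩ hr w) u hq,
      ← dirDeriv_inner hΩ (contDiffOn_dirDeriv hΩ hs v) (contDiffOn_dirDeriv hΩ hs w) u hq]
    exact dirDeriv_congr hΩ (h v w) u hq
  -- The Koszul combination k1 + k2 - k3: by symmetry of second derivatives all terms cancel except
  -- twice ⟨r_uv, r_w⟩.
  have k1 := key u v w
  have k2 := key v u w
  have k3 := key w u v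
  rw [dirDeriv_comm hΩ hr v u hq, dirDeriv_comm hΩ hs v u hq] at k2
  rw [dirDeriv_comm hΩ hr w u hq, dirDeriv_comm hΩ hs w u hq,
    dirDeriv_comm hΩ hr w v hq, dirDeriv_comm hΩ hs w v hq] at k3
  simp only [real_inner_comm (dirDeriv u (dirDeriv w _) q),
    real_inner_comm (dirDeriv v (dirDeriv w _) q)] at k1 k2 k3 ⊢
  linarith [real_inner_comm (dirDeriv u (dirDeriv w r) q) (dirDeriv v r q),
    real_inner_comm (dirDeriv u (dirDeriv w s) q) (dirDeriv v s q)]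

/-- The curvature expression of an immersion depends only on the induced metric. -/
theorem inner_sub_inner_eq_of_isometric (hΩ : IsOpen Ω) (hr : ContDiffOn ℝ ∞ r Ω)
    (hs : ContDiffOn ℝ ∞ s Ω)
    (h : ∀ v w : V, ∀ q ∈ Ω, inner ℝ (dirDeriv v r q) (dirDeriv w r q)
      = inner ℝ (dirDeriv v s q) (dirDeriv w s q)) (v w : V) {q : V} (hq : q ∈ Ω) :
    inner ℝ (dirDeriv v (dirDeriv v r) q) (dirDeriv w (dirDeriv w r) q)
        - inner ℝ (dirDeriv v (dirDeriv w r) q) (dirDeriv v (dirDeriv w r) q)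
      = inner ℝ (dirDeriv v (dirDeriv v s) q) (dirDeriv w (dirDeriv w s) q)
        - inner ℝ (dirDeriv v (dirDeriv w s) q) (dirDeriv v (dirDeriv w s) q) := by
  have key : ∀ z u v w : V,
      inner ℝ (dirDeriv u (dirDeriv v r) q) (dirDeriv z (dirDeriv w r) q)
        + inner ℝ (dirDeriv z (dirDeriv u (dirDeriv v r)) q) (dirDeriv w r q)
      = inner ℝ (dirDeriv u (dirDeriv v s) q) (dirDeriv z (dirDeriv w s) q)
        + inner ℝ (dirDeriv z (dirDeriv u (dirDeriv v s)) q) (dirDeriv w s q) :=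
    fun z u v w => by
    rw [← dirDeriv_inner hΩ (contDiffOn_dirDeriv hΩ (contDiffOn_dirDeriv hΩ hr v) u)
        (contDiffOn_dirDeriv hΩ hr w) z hq,
      ← dirDeriv_inner hΩ (contDiffOn_dirDeriv hΩ (contDiffOn_dirDeriv hΩ hs v) u)
        (contDiffOn_dirDeriv hΩ hs w) z hq]
    exact dirDeriv_congr hΩ
      (fun q hq => inner_dirDeriv_dirDeriv_eq_of_isometric hΩ hr hs h u v w hq) z hq
  -- Both identities contain the same third derivative, paired with the derivative along `w`;
  -- subtracting them eliminates it.
  have k1 := key w v v w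
  have k2 := key v w v w
  rw [dirDeriv_comm hΩ (contDiffOn_dirDeriv hΩ hr v) w v hq,
    dirDeriv_comm hΩ (contDiffOn_dirDeriv hΩ hs v) w v hq] at k1
  rw [dirDeriv_comm hΩ hr w v hq, dirDeriv_comm hΩ hs w v hq] at k2
  linarith

end Calculus

/-! ### Length and speed -/

section Length

/-- A curve that is no longer than a differentiable one has no greater speed. -/
theorem norm_deriv_le_of_eVariationOn_le {F G : Type*} [NormedAddCommGroup F] [NormedSpace ℝ F]
    [NormedAddCommGroup G] [NormedSpace ℝ G] {α : ℝ → F} {β : ℝ → G} {α' : F} {β' : G} {ε : ℝ}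
    (hε : 0 < ε) (hα : HasDerivAt α α' 0) (hβ : HasStrictDerivAt β β' 0)
    (h : ∀ t ∈ Set.Ioo 0 ε, eVariationOn α (Set.Icc 0 t) ≤ eVariationOn β (Set.Icc 0 t)) :
    ‖α'‖ ≤ ‖β'‖ := by
  -- For any C > ‖β'‖, strict differentiability makes `β` C-Lipschitz near 0. Its length on [0, t]
  -- is then at most C t, which bounds the chord of `α`; dividing by t and letting t → 0⁺ gives ‖α'‖
  -- ≤ C.
  refine le_of_forall_gt_imp_ge_of_dense fun C hC => ?_
  obtain ⟨K, hK⟩ : ∃ K : NNReal, (K : ℝ) = C := ⟨⟨C, (norm_nonneg _).trans hC.le⟩, rfl⟩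
  have hK' : ‖ContinuousLinearMap.toSpanSingleton ℝ β'‖₊ < K := by
    rw [← NNReal.coe_lt_coe, hK]; simp [hC]
  obtain ⟨s, hs, hlip⟩ := hβ.hasStrictFDerivAt.exists_lipschitzOnWith_of_nnnorm_lt K hK'
  obtain ⟨δ, hδ, hball⟩ := Metric.mem_nhds_iff.1 hs
  have hbound : ∀ t ∈ Set.Ioo 0 (min ε δ), ‖α t - α 0‖ ≤ C * t := by
    intro t ht
    have hsub : Set.Icc 0 t ⊆ s := fun x hx => hball (by
      rw [Metric.mem_ball, Real.dist_eq, sub_zero, abs_of_nonneg hx.1]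
      exact lt_of_le_of_lt hx.2 (ht.2.trans_le (min_le_right _ _)))
    have h1 : edist (α t) (α 0) ≤ eVariationOn α (Set.Icc 0 t) :=
      eVariationOn.edist_le α (Set.right_mem_Icc.2 ht.1.le) (Set.left_mem_Icc.2 ht.1.le)
    have h2 : eVariationOn β (Set.Icc 0 t) ≤ K * eVariationOn id (Set.Icc 0 t) :=
      (hlip.mono hsub).comp_eVariationOn_le (g := id) (s := Set.Icc 0 t) (fun x hx => hx)
    have h3 : eVariationOn (id : ℝ → ℝ) (Set.Icc 0 t) ≤ ENNReal.ofReal t := by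
      have := (monotone_id.monotoneOn (Set.Icc 0 t)).eVariationOn_eq (a := 0) (b := t)
        (Set.left_mem_Icc.2 ht.1.le) (Set.right_mem_Icc.2 ht.1.le)
      rw [Set.inter_self] at this
      simp [this]
    have h4 : edist (α t) (α 0) ≤ ENNReal.ofReal (C * t) := by
      rw [← hK, ENNReal.ofReal_mul K.coe_nonneg, ENNReal.ofReal_coe_nnreal]
      exact h1.trans ((h t ⟨ht.1, ht.2.trans_le (min_le_left _ _)⟩).trans
        (h2.trans (mul_le_mul_right h3 (K : ENNReal))))
    rw [edist_dist, ENNReal.ofReal_le_ofReal_iff (by rw [← hK]; exact mul_nonneg K.2 ht.1.le),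
      dist_eq_norm] at h4
    exact h4
  have hlim := (hasDerivAt_iff_tendsto_slope_zero.1 hα).norm
  have hlim' : Filter.Tendsto (fun t : ℝ => ‖t⁻¹ • (α (0 + t) - α 0)‖) (nhdsWithin 0 (Set.Ioi 0))
      (nhds ‖α'‖) := hlim.mono_left (nhdsWithin_mono _ fun x hx => ne_of_gt hx)
  refine le_of_tendsto hlim' ?_
  filter_upwards [Ioo_mem_nhdsGT (lt_min hε hδ)] with t ht
  rw [zero_add, norm_smul, norm_inv, Real.norm_of_nonneg ht.1.le, inv_mul_le_iff₀ ht.1, mul_comm]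
  exact hbound t ht

end Length

/-! ### Graph parametrizations and tangent vectors -/

section Coordinates

variable (o : E3) (b : OrthonormalBasis (Fin 3) ℝ E3)

/-- The parametrization `(x, y) ↦ (x, y, h (x, y))` of a graph. -/
noncomputable def graphMap (h : ℝ × ℝ → ℝ) (q : ℝ × ℝ) : E3 :=
  o + (q.1 • b 0 + q.2 • b 1 + h q • b 2)

theorem repr_lin_comb (x y z : ℝ) (i : Fin 3) :
    b.repr (x • b 0 + y • b 1 + z • b 2) i = ![x, y, z] i := by
  fin_cases i <;> simp

@[simp] theorem coordXY_graphMap (h : ℝ × ℝ → ℝ) (q : ℝ × ℝ) :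
    coordXY o b (graphMap o b h q) = q := by
  simp only [coordXY, graphMap, add_sub_cancel_left, repr_lin_comb]
  rfl

@[simp] theorem coordZ_graphMap (h : ℝ × ℝ → ℝ) (q : ℝ × ℝ) :
    coordZ o b (graphMap o b h q) = h q := by
  simp only [coordZ, graphMap, add_sub_cancel_left, repr_lin_comb]
  rfl

variable {o b}

theorem eq_of_coord_eq {x y : E3} (h₁ : coordXY o b x = coordXY o b y)
    (h₂ : coordZ o b x = coordZ o b y) : x = y := by
  have h : b.repr (x - o) = b.repr (y - o) := by
    simp only [coordXY, Prod.mk.injEq] at h₁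
    ext i
    fin_cases i
    exacts [h₁.1, h₁.2, h₂]
  simpa using b.repr.injective h

theorem graph_eq_image (Ω : Set (ℝ × ℝ)) (h : ℝ × ℝ → ℝ) :
    {q | coordXY o b q ∈ Ω ∧ coordZ o b q = h (coordXY o b q)} = graphMap o b h '' Ω := by
  ext q
  constructor
  · rintro ⟨h₁, h₂⟩
    exact ⟨_, h₁, eq_of_coord_eq (o := o) (b := b) (by simp) (by simp [h₂])⟩
  · rintro ⟨w, hw, rfl⟩
    simp [hw]

variable (o b) in
theorem contDiff_coordXY : ContDiff ℝ ∞ (coordXY o b) := by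
  unfold coordXY
  simp only [OrthonormalBasis.repr_apply_apply]
  exact (contDiff_const.inner ℝ (contDiff_id.sub contDiff_const)).prodMk
    (contDiff_const.inner ℝ (contDiff_id.sub contDiff_const))

variable (o b) in
theorem contDiff_coordZ : ContDiff ℝ ∞ (coordZ o b) := by
  unfold coordZ
  simp only [OrthonormalBasis.repr_apply_apply]
  exact contDiff_const.inner ℝ (contDiff_id.sub contDiff_const)

theorem contDiffOn_graphMap {Ω : Set (ℝ × ℝ)} {h : ℝ × ℝ → ℝ} (hh : ContDiffOn ℝ ∞ h Ω) :
    ContDiffOn ℝ ∞ (graphMap o b h) Ω := by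
  unfold graphMap
  fun_prop

theorem hasFDerivAt_graphMap {h : ℝ × ℝ → ℝ} {q : ℝ × ℝ} (hh : DifferentiableAt ℝ h q) :
    HasFDerivAt (graphMap o b h)
      ((ContinuousLinearMap.fst ℝ ℝ ℝ).smulRight (b 0)
        + (ContinuousLinearMap.snd ℝ ℝ ℝ).smulRight (b 1) + (fderiv ℝ h q).smulRight (b 2)) q :=
  (((hasFDerivAt_fst.smul_const (b 0)).add (hasFDerivAt_snd.smul_const (b 1))).add
    (hh.hasFDerivAt.smul_const (b 2))).const_add o

theorem dirDeriv_graphMap {h : ℝ × ℝ → ℝ} {q : ℝ × ℝ} (hh : DifferentiableAt ℝ h q) (v : ℝ × ℝ) :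
    dirDeriv v (graphMap o b h) q = v.1 • b 0 + v.2 • b 1 + dirDeriv v h q • b 2 := by
  rw [dirDeriv, (hasFDerivAt_graphMap hh).fderiv]
  rfl

theorem dirDeriv_dirDeriv_graphMap {Ω : Set (ℝ × ℝ)} (hΩ : IsOpen Ω) {h : ℝ × ℝ → ℝ}
    (hh : ContDiffOn ℝ ∞ h Ω) (v w : ℝ × ℝ) {q : ℝ × ℝ} (hq : q ∈ Ω) :
    dirDeriv v (dirDeriv w (graphMap o b h)) q = dirDeriv v (dirDeriv w h) q • b 2 := by
  rw [dirDeriv_congr hΩ (fun x hx => dirDeriv_graphMap (o := o) (b := b)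
    (differentiableAt_of_contDiffOn hΩ hh hx) w) v hq]
  have := differentiableAt_of_contDiffOn hΩ (contDiffOn_dirDeriv hΩ hh w) hq
  have h2 := (this.hasFDerivAt.smul_const (b 2)).const_add (w.1 • b 0 + w.2 • b 1)
  rw [dirDeriv, h2.fderiv]
  rfl

variable {S : Set E3} {p : E3} {Ω : Set (ℝ × ℝ)} {h : ℝ × ℝ → ℝ}

theorem IsLocalGraphAt.mapsTo (H : IsLocalGraphAt S p o b Ω h) :
    Set.MapsTo (graphMap o b h) Ω S := by
  obtain ⟨-, -, U, -, -, hU⟩ := H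
  rw [graph_eq_image] at hU
  exact fun q hq => (hU.symm.subset ⟨q, hq, rfl⟩).2

theorem IsLocalGraphAt.coordXY_mem (H : IsLocalGraphAt S p o b Ω h) (hp : p ∈ S) :
    coordXY o b p ∈ Ω := by
  obtain ⟨-, -, U, -, hpU, hU⟩ := H
  exact (hU.subset ⟨hpU, hp⟩).1

theorem IsLocalGraphAt.graphMap_coordXY (H : IsLocalGraphAt S p o b Ω h) (hp : p ∈ S) :
    graphMap o b h (coordXY o b p) = p := by
  obtain ⟨-, -, U, -, hpU, hU⟩ := H
  have := (hU.subset ⟨hpU, hp⟩).2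
  exact eq_of_coord_eq (o := o) (b := b) (by simp) (by simp [this])

theorem IsLocalGraphAt.isChart (H : IsLocalGraphAt S p o b Ω h) :
    IsChart S Ω (graphMap o b h) where
  isOpen := H.1
  smooth := contDiffOn_graphMap H.2.1
  regular q hq := by
    change LinearIndependent ℝ ![dirDeriv (1, 0) (graphMap o b h) q,
      dirDeriv (0, 1) (graphMap o b h) q]
    have hd := differentiableAt_of_contDiffOn H.1 H.2.1 hq
    rw [LinearIndependent.pair_iff, dirDeriv_graphMap hd, dirDeriv_graphMap hd]
    intro s t hst
    have hst' : s • b 0 + t • b 1 + (s * dirDeriv (1, 0) h q + t * dirDeriv (0, 1) h q) • b 2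
        = 0 := by
      rw [← hst]; module
    have hi := repr_lin_comb b s t (s * dirDeriv (1, 0) h q + t * dirDeriv (0, 1) h q)
    rw [hst'] at hi
    exact ⟨by simpa using (hi 0).symm, by simpa using (hi 1).symm⟩
  embedding := by
    -- Projection to the (x, y)-plane is a continuous left inverse, so the composite is the
    -- inclusion of `Ω`.
    refine Topology.IsEmbedding.of_comp (g := coordXY o b)
      (continuousOn_iff_continuous_domRestrict.1 (contDiffOn_graphMap H.2.1).continuousOn)
      (contDiff_coordXY o b).continuous ?_
    convert Topology.IsEmbedding.subtypeVal (p := (· ∈ Ω)) using 1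
    ext q : 1
    simp
  image := by
    obtain ⟨-, -, U, hUo, -, hU⟩ := H
    exact ⟨U, hUo, by rw [hU, graph_eq_image]⟩

end Coordinates

/-- Velocities of differentiable curves in a graph. -/
theorem IsLocalGraphAt.tangentVectors_eq {o : E3} {b : OrthonormalBasis (Fin 3) ℝ E3}
    {S : Set E3} {p : E3} {Ω : Set (ℝ × ℝ)} {h : ℝ × ℝ → ℝ}
    (H : IsLocalGraphAt S p o b Ω h) (hp : p ∈ S) :
    tangentVectors S p = Set.range (fderiv ℝ (graphMap o b h) (coordXY o b p)) := by
  have hm := H.mapsTo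
  have hq := H.coordXY_mem hp
  have hgp := H.graphMap_coordXY hp
  have hg := contDiffOn_graphMap (o := o) (b := b) H.2.1
  obtain ⟨hΩ, -, U, hUo, hpU, hU⟩ := H
  have hd := (differentiableAt_of_contDiffOn hΩ hg hq).hasFDerivAt
  ext w
  constructor
  · rintro ⟨γ, ε, hε, hγ, hγS, h0, hw⟩
    have hφ := ((contDiff_coordXY o b).differentiable (by simp) (γ 0)).hasFDerivAt.comp_hasDerivAt
      (0 : ℝ) hw
    have hd' : HasFDerivAt (graphMap o b h) (fderiv ℝ (graphMap o b h) (coordXY o b p))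
      ((coordXY o b ∘ γ) 0) := by simpa [h0] using hd
    have hcomp := hd'.comp_hasDerivAt (0 : ℝ) hφ
    -- Near time 0 the curve stays in `U`, so it is the lift of its own projection.
    have heq : graphMap o b h ∘ (coordXY o b ∘ γ) =ᶠ[nhds 0] γ := by
      filter_upwards [hw.continuousAt.preimage_mem_nhds (hUo.mem_nhds (h0 ▸ hpU)),
        Ioo_mem_nhds (neg_neg_iff_pos.2 hε) hε] with t ht ht'
      have := (hU.subset ⟨ht, hγS ht'⟩).2
      exact eq_of_coord_eq (o := o) (b := b) (by simp) (by simp [this])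
    exact ⟨_, (hcomp.congr_of_eventuallyEq heq.symm).unique hw⟩
  · rintro ⟨v, rfl⟩
    have hcont : Continuous fun t : ℝ => coordXY o b p + t • v := by fun_prop
    have hsm : ContDiff ℝ ∞ fun t : ℝ => coordXY o b p + t • v := by fun_prop
    obtain ⟨ε, hε, hball⟩ := Metric.isOpen_iff.1 (hΩ.preimage hcont) 0 (by simpa using hq)
    rw [Real.ball_eq_Ioo, zero_sub, zero_add] at hball
    refine ⟨fun t => graphMap o b h (coordXY o b p + t • v), ε, hε,
      hg.comp hsm.contDiffOn hball, fun t ht => hm (hball ht), by simpa using hgp, ?_⟩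
    have hl : HasDerivAt (fun t : ℝ => coordXY o b p + t • v) v 0 := by
      simpa using ((hasDerivAt_id (0 : ℝ)).smul_const v).const_add (coordXY o b p)
    exact HasFDerivAt.comp_hasDerivAt (0 : ℝ) (by simpa using hd) hl

/-! ### Smooth local inverses -/

section InverseFunction

variable {V : Type*} [NormedAddCommGroup V] [NormedSpace ℝ V] [FiniteDimensional ℝ V]

/-- The inverse function theorem with an inverse that is smooth on an open set. -/
theorem exists_openPartialHomeomorph_contDiffOn_symm {φ : V → V} {Ω : Set V} {q : V}
    (hΩ : IsOpen Ω) (hφ : ContDiffOn ℝ ∞ φ Ω) (hq : q ∈ Ω)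
    (hinj : Function.Injective (fderiv ℝ φ q)) :
    ∃ e : OpenPartialHomeomorph V V, q ∈ e.source ∧ e.source ⊆ Ω ∧ (e : V → V) = φ ∧
      ContDiffOn ℝ ∞ e.symm e.target := by
  have : CompleteSpace V := FiniteDimensional.complete ℝ V
  have hequiv : fderiv ℝ φ q ∈
      Set.range (ContinuousLinearEquiv.toContinuousLinearMap : (V ≃L[ℝ] V) → V →L[ℝ] V) :=
    ⟨(LinearEquiv.ofInjectiveEndo (fderiv ℝ φ q : V →ₗ[ℝ] V) hinj).toContinuousLinearEquiv, by
      ext; simp⟩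
  -- Restricting to the open set where the derivative is invertible makes the inverse smooth on its
  -- whole domain, not only at the image of `q`.
  have hW : IsOpen (Ω ∩ fderiv ℝ φ ⁻¹'
      Set.range (ContinuousLinearEquiv.toContinuousLinearMap : (V ≃L[ℝ] V) → V →L[ℝ] V)) :=
    (hφ.continuousOn_fderiv_of_isOpen hΩ (by simp)).isOpen_inter_preimage hΩ
      ContinuousLinearEquiv.isOpen
  obtain ⟨L, hL⟩ := id hequiv
  have hd : HasFDerivAt φ (L : V →L[ℝ] V) q :=
    hL ▸ (differentiableAt_of_contDiffOn hΩ hφ hq).hasFDerivAt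
  let e := (hφ.contDiffAt (hΩ.mem_nhds hq)).toOpenPartialHomeomorph φ hd (by simp)
  have he : q ∈ e.source :=
    (hφ.contDiffAt (hΩ.mem_nhds hq)).mem_toOpenPartialHomeomorph_source hd (by simp)
  refine ⟨e.restrOpen _ hW, ⟨he, hq, hequiv⟩, fun x hx => hx.2.1, rfl, fun y hy => ?_⟩
  obtain ⟨-, hyΩ, L', hL'⟩ := (e.restrOpen _ hW).map_target hy
  refine ((e.restrOpen _ hW).contDiffAt_symm (f₀' := L') hy ?_
    (hφ.contDiffAt (hΩ.mem_nhds hyΩ))).contDiffWithinAt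
  rw [hL']
  exact (differentiableAt_of_contDiffOn hΩ hφ hyΩ).hasFDerivAt

end InverseFunction

/-! ### Existence of tangent-normal coordinates -/

theorem hasFDerivAt_coordXY (o : E3) (b : OrthonormalBasis (Fin 3) ℝ E3) (x : E3) :
    HasFDerivAt (coordXY o b) ((innerSL ℝ (b 0)).prod (innerSL ℝ (b 1))) x := by
  unfold coordXY
  simp only [OrthonormalBasis.repr_apply_apply]
  exact (((innerSL ℝ (b 0)).hasFDerivAt (x := x - o)).comp x ((hasFDerivAt_id x).sub_const o)).prodMk
    (((innerSL ℝ (b 1)).hasFDerivAt (x := x - o)).comp x ((hasFDerivAt_id x).sub_const o))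

theorem hasFDerivAt_coordZ (o : E3) (b : OrthonormalBasis (Fin 3) ℝ E3) (x : E3) :
    HasFDerivAt (coordZ o b) (innerSL ℝ (b 2)) x := by
  unfold coordZ
  simp only [OrthonormalBasis.repr_apply_apply]
  exact ((innerSL ℝ (b 2)).hasFDerivAt (x := x - o)).comp x ((hasFDerivAt_id x).sub_const o)

/-- An orthonormal basis of the space adapted to a plane. -/
theorem exists_orthonormalBasis_span_eq (P : Submodule ℝ E3) (hP : Module.finrank ℝ P = 2) :
    ∃ b : OrthonormalBasis (Fin 3) ℝ E3, Submodule.span ℝ {b 0, b 1} = P := by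
  let u : OrthonormalBasis (Fin 2) ℝ P := (stdOrthonormalBasis ℝ P).reindex (finCongr hP)
  have hon : Orthonormal ℝ (Set.domRestrict ({0, 1} : Set (Fin 3)) ![(u 0 : E3), u 1, 0]) := by
    have h : ∀ i j, inner ℝ (u i : E3) (u j : E3) = if i = j then (1 : ℝ) else 0 :=
      orthonormal_iff_ite.1 u.orthonormal
    rw [orthonormal_iff_ite]
    rintro ⟨i, rfl | rfl⟩ ⟨j, rfl | rfl⟩
    exacts [(h 0 0).trans (if_pos rfl).symm, (h 0 1).trans (if_neg fun e => by cases e).symm,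
      (h 1 0).trans (if_neg fun e => by cases e).symm, (h 1 1).trans (if_pos rfl).symm]
  obtain ⟨b, hb⟩ := hon.exists_orthonormalBasis_extension_of_card_eq (by simp)
  have hb0 : b 0 = u 0 := by simpa using hb 0 (by simp)
  have hb1 : b 1 = u 1 := by simpa using hb 1 (by simp)
  refine ⟨b, le_antisymm (Submodule.span_le.2 ?_) fun x hx => ?_⟩
  · rintro x (rfl | rfl)
    · rw [hb0]; exact (u 0).2
    · rw [hb1]; exact (u 1).2
  · have h := congrArg Subtype.val (u.sum_repr ⟨x, hx⟩)
    rw [Fin.sum_univ_two] at h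
    rw [Submodule.mem_span_pair]
    exact ⟨_, _, by rw [hb0, hb1]; exact h⟩

theorem IsChart.injective_fderiv {S : Set E3} {U : Set (ℝ × ℝ)} {s : ℝ × ℝ → E3}
    (H : IsChart S U s) {q : ℝ × ℝ} (hq : q ∈ U) : Function.Injective (fderiv ℝ s q) := by
  rw [injective_iff_map_eq_zero]
  intro v hv
  have hv' : v = v.1 • ((1, 0) : ℝ × ℝ) + v.2 • ((0, 1) : ℝ × ℝ) := by ext <;> simp
  rw [hv', map_add, map_smul, map_smul] at hv
  obtain ⟨h1, h2⟩ := LinearIndependent.pair_iff.1 (H.regular q hq) _ _ hv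
  exact Prod.ext h1 h2

/-- Every point of a smooth surface has tangent-normal coordinates. -/
theorem IsLocalGraphAt.exists_isTangentNormalAt {o : E3} {b : OrthonormalBasis (Fin 3) ℝ E3}
    {S : Set E3} {p : E3} {Ω : Set (ℝ × ℝ)} {h : ℝ × ℝ → ℝ}
    (H : IsLocalGraphAt S p o b Ω h) (hp : p ∈ S) :
    ∃ (b' : OrthonormalBasis (Fin 3) ℝ E3) (Ω' : Set (ℝ × ℝ)) (h' : ℝ × ℝ → ℝ),
      IsTangentNormalAt S p b' Ω' h' := by
  have hT := H.tangentVectors_eq hp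
  have hq := H.coordXY_mem hp
  have hgp := H.graphMap_coordXY hp
  have hinj := H.isChart.injective_fderiv hq
  have hg := contDiffOn_graphMap (o := o) (b := b) H.2.1
  obtain ⟨hΩ, -, U, hUo, hpU, hU⟩ := H
  rw [graph_eq_image] at hU
  set q := coordXY o b p with hqdef
  set s := graphMap o b h with hs
  set D : ℝ × ℝ →L[ℝ] E3 := fderiv ℝ s q with hD
  obtain ⟨b', hb'⟩ := exists_orthonormalBasis_span_eq (LinearMap.range (D : ℝ × ℝ →ₗ[ℝ] E3))
    (by rw [LinearMap.finrank_range_of_inj hinj]; simp)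
  have hφ : ContDiffOn ℝ ∞ (coordXY p b' ∘ s) Ω := (contDiff_coordXY p b').comp_contDiffOn hg
  have hφd : HasFDerivAt (coordXY p b' ∘ s) (((innerSL ℝ (b' 0)).prod (innerSL ℝ (b' 1))).comp D) q :=
    (hasFDerivAt_coordXY p b' (s q)).comp q (differentiableAt_of_contDiffOn hΩ hg hq).hasFDerivAt
  -- Projection to the tangent plane is injective on tangent vectors, so the parametrization can be
  -- reparametrized by its new (x, y)-coordinates; the new height function is the new z-coordinate.
  obtain ⟨e, hqe, heΩ, heφ, hes⟩ := exists_openPartialHomeomorph_contDiffOn_symm hΩ hφ hq (by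
    rw [hφd.fderiv, injective_iff_map_eq_zero]
    intro v hv
    have hmem : D v ∈ Submodule.span ℝ {b' 0, b' 1} := hb' ▸ ⟨v, rfl⟩
    obtain ⟨x, y, hxy⟩ := Submodule.mem_span_pair.1 hmem
    have h0 : inner ℝ (b' 0) (D v) = 0 := congrArg Prod.fst hv
    have h1 : inner ℝ (b' 1) (D v) = 0 := congrArg Prod.snd hv
    rw [← hxy, inner_add_right, inner_smul_right, inner_smul_right] at h0 h1
    simp at h0 h1
    apply hinj
    rw [map_zero, ← hxy, h0, h1, zero_smul, zero_smul, add_zero])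
  have heq : ∀ v, e v = coordXY p b' (s v) := fun v => congrFun heφ v
  refine ⟨b', e.target, coordZ p b' ∘ s ∘ e.symm, ?_, e.open_target,
    (contDiff_coordZ p b').comp_contDiffOn (hg.comp hes fun y hy => heΩ (e.map_target hy)),
    U ∩ coordXY o b ⁻¹' e.source, hUo.inter (e.open_source.preimage
      (contDiff_coordXY o b).continuous), ⟨hpU, hqe⟩, ?_⟩
  · rw [hT, hb']; rfl
  · ext x
    constructor
    · rintro ⟨⟨hxU, hx⟩, hxS⟩
      obtain ⟨v, hv, rfl⟩ := hU.subset ⟨hxU, hxS⟩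
      rw [Set.mem_preimage, hs, coordXY_graphMap] at hx
      refine ⟨heq v ▸ e.map_source hx, ?_⟩
      rw [← heq v]
      simp [e.left_inv hx]
    · rintro ⟨hx1, hx2⟩
      have hsrc := e.map_target hx1
      have hxs : s (e.symm (coordXY p b' x)) = x :=
        eq_of_coord_eq (o := p) (b := b') (by rw [← heq, e.right_inv hx1]) hx2.symm
      have := hU.superset ⟨_, heΩ hsrc, hxs⟩
      refine ⟨⟨this.1, ?_⟩, this.2⟩
      rw [Set.mem_preimage, ← hxs, hs, coordXY_graphMap]
      exact hsrc

/-! ### Polarization and second derivatives of composites -/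

section Metric

variable {V F : Type*} [NormedAddCommGroup V] [NormedSpace ℝ V]
  [NormedAddCommGroup F] [InnerProductSpace ℝ F]

/-- Maps with equal speeds in all directions induce equal metrics. -/
theorem inner_dirDeriv_eq_of_norm_eq {G : Type*} [NormedAddCommGroup G] [InnerProductSpace ℝ G]
    {r : V → F} {s : V → G} {q : V} (h : ∀ v, ‖dirDeriv v r q‖ = ‖dirDeriv v s q‖) (v w : V) :
    inner ℝ (dirDeriv v r q) (dirDeriv w r q) = inner ℝ (dirDeriv v s q) (dirDeriv w s q) := by
  have hr : dirDeriv (v + w) r q = dirDeriv v r q + dirDeriv w r q := map_add _ _ _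
  have hs : dirDeriv (v + w) s q = dirDeriv v s q + dirDeriv w s q := map_add _ _ _
  rw [real_inner_eq_norm_add_mul_self_sub_norm_mul_self_sub_norm_mul_self_div_two,
    real_inner_eq_norm_add_mul_self_sub_norm_mul_self_sub_norm_mul_self_div_two, ← hr, ← hs,
    h, h, h]

end Metric

/-- The second derivative of a composition at a critical point of the outer function. -/
theorem dirDeriv_dirDeriv_comp {V W F : Type*} [NormedAddCommGroup V] [NormedSpace ℝ V]
    [NormedAddCommGroup W] [NormedSpace ℝ W] [NormedAddCommGroup F] [NormedSpace ℝ F]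
    {g : W → F} {φ : V → W} {Ω : Set V} {Ω' : Set W} (hΩ : IsOpen Ω) (hΩ' : IsOpen Ω')
    (hg : ContDiffOn ℝ ∞ g Ω') (hφ : ContDiffOn ℝ ∞ φ Ω) (hm : Set.MapsTo φ Ω Ω')
    {q : V} (hq : q ∈ Ω) (hcrit : fderiv ℝ g (φ q) = 0) (v w : V) :
    dirDeriv v (dirDeriv w (g ∘ φ)) q
      = fderiv ℝ (fderiv ℝ g) (φ q) (dirDeriv v φ q) (dirDeriv w φ q) := by
  have h1 : Set.EqOn (dirDeriv w (g ∘ φ)) (fun x => fderiv ℝ g (φ x) (dirDeriv w φ x)) Ω := by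
    intro x hx
    rw [dirDeriv, fderiv_comp x (differentiableAt_of_contDiffOn hΩ' hg (hm hx))
      (differentiableAt_of_contDiffOn hΩ hφ hx)]
    rfl
  rw [dirDeriv_congr hΩ h1 v hq]
  have hg' := differentiableAt_of_contDiffOn hΩ'
    (hg.fderiv_of_isOpen hΩ' (m := ∞) (by simp)) (hm hq)
  have hφ' := differentiableAt_of_contDiffOn hΩ hφ hq
  have h2 : HasFDerivAt (fun x => fderiv ℝ g (φ x)) _ q :=
    hg'.hasFDerivAt.comp q hφ'.hasFDerivAt
  have h3 := (differentiableAt_of_contDiffOn hΩ (contDiffOn_dirDeriv hΩ hφ w) hq).hasFDerivAt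
  rw [dirDeriv, (h2.clm_apply h3).fderiv]
  -- The term with the second derivative of `φ` is killed by the vanishing derivative of `g`.
  simp [hcrit, dirDeriv]

/-! ### Tangent-normal coordinates and invariance of the Hessian determinant -/

section TangentNormal

variable {S : Set E3} {p : E3} {b : OrthonormalBasis (Fin 3) ℝ E3} {Ω : Set (ℝ × ℝ)}
  {h : ℝ × ℝ → ℝ}

@[simp] theorem coordXY_self (p : E3) (b : OrthonormalBasis (Fin 3) ℝ E3) :
    coordXY p b p = 0 := by
  simp [coordXY]

theorem IsTangentNormalAt.zero_mem (H : IsTangentNormalAt S p b Ω h) (hp : p ∈ S) :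
    (0 : ℝ × ℝ) ∈ Ω := by
  simpa using H.graph.coordXY_mem hp

theorem IsTangentNormalAt.inner_eq_zero (H : IsTangentNormalAt S p b Ω h) {w : E3}
    (hw : w ∈ tangentVectors S p) : inner ℝ (b 2) w = 0 := by
  rw [H.tangent] at hw
  obtain ⟨x, y, rfl⟩ := Submodule.mem_span_pair.1 hw
  simp [inner_add_right, inner_smul_right]

/-- The graph's velocity in direction v has `b 2`-component dh(v), and tangent vectors have none. -/
theorem IsTangentNormalAt.fderiv_eq_zero (H : IsTangentNormalAt S p b Ω h) (hp : p ∈ S) :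
    fderiv ℝ h 0 = 0 := by
  refine ContinuousLinearMap.ext fun v => ?_
  have hd := differentiableAt_of_contDiffOn H.graph.1 H.graph.2.1 (H.zero_mem hp)
  have hw : dirDeriv v (graphMap p b h) 0 ∈ tangentVectors S p := by
    rw [H.graph.tangentVectors_eq hp, coordXY_self]
    exact ⟨v, rfl⟩
  have := H.inner_eq_zero hw
  rw [dirDeriv_graphMap hd] at this
  simpa [inner_add_right, inner_smul_right, dirDeriv] using this

end TangentNormal

/-- A length-preserving map preserves the norms of the directional derivatives of a
parametrization. -/
theorem norm_dirDeriv_comp_eq {S : Set E3} {f : E3 → E3} {Ω : Set (ℝ × ℝ)} {s : ℝ × ℝ → E3}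
    (hf : IsLengthPreservingOn S f) (hΩ : IsOpen Ω) (hs : ContDiffOn ℝ ∞ s Ω)
    (hfs : ContDiffOn ℝ ∞ (f ∘ s) Ω) (hm : Set.MapsTo s Ω S) {q : ℝ × ℝ} (hq : q ∈ Ω)
    (v : ℝ × ℝ) : ‖dirDeriv v (f ∘ s) q‖ = ‖dirDeriv v s q‖ := by
  have hcont : ContDiff ℝ ∞ fun t : ℝ => q + t • v := by fun_prop
  obtain ⟨ε, hε, hball⟩ := Metric.isOpen_iff.1 (hΩ.preimage hcont.continuous) 0 (by simpa using hq)
  have hsub : ∀ t ∈ Set.Ioo 0 ε, Set.MapsTo (fun t : ℝ => q + t • v) (Set.Icc 0 t) Ω := by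
    intro t ht x hx
    apply hball
    rw [Metric.mem_ball, Real.dist_eq, sub_zero, abs_of_nonneg hx.1]
    exact hx.2.trans_lt ht.2
  have hd : ∀ g : ℝ × ℝ → E3, ContDiffOn ℝ ∞ g Ω →
      HasStrictDerivAt (g ∘ fun t : ℝ => q + t • v) (dirDeriv v g q) 0 := by
    intro g hg
    have h1 : HasStrictFDerivAt g (fderiv ℝ g q) (q + (0 : ℝ) • v) := by
      simpa using (hg.contDiffAt (hΩ.mem_nhds hq)).hasStrictFDerivAt (by simp)
    have h2 : HasStrictDerivAt (fun t : ℝ => q + t • v) v 0 := by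
      simpa using ((hasStrictDerivAt_id (0 : ℝ)).smul_const v).const_add q
    exact h1.comp_hasStrictDerivAt (0 : ℝ) h2
  have hlen : ∀ t ∈ Set.Ioo 0 ε,
      eVariationOn ((f ∘ s) ∘ fun t : ℝ => q + t • v) (Set.Icc 0 t)
        = eVariationOn (s ∘ fun t : ℝ => q + t • v) (Set.Icc 0 t) := fun t ht =>
    hf (Set.Icc 0 t) (s ∘ fun t : ℝ => q + t • v) Set.ordConnected_Icc
      (hs.continuousOn.comp hcont.continuous.continuousOn (hsub t ht)) (hm.comp (hsub t ht))
  exact le_antisymm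
    (norm_deriv_le_of_eVariationOn_le hε (hd _ hfs).hasDerivAt (hd _ hs) fun t ht => (hlen t ht).le)
    (norm_deriv_le_of_eVariationOn_le hε (hd _ hs).hasDerivAt (hd _ hfs) fun t ht => (hlen t ht).ge)

theorem det_hessianMatrix {h : ℝ × ℝ → ℝ} {Ω : Set (ℝ × ℝ)} (hΩ : IsOpen Ω)
    (hh : ContDiffOn ℝ ∞ h Ω) (h0 : (0 : ℝ × ℝ) ∈ Ω) :
    (hessianMatrix h).det = dirDeriv (1, 0) (dirDeriv (1, 0) h) 0
        * dirDeriv (0, 1) (dirDeriv (0, 1) h) 0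
      - dirDeriv (1, 0) (dirDeriv (0, 1) h) 0 * dirDeriv (1, 0) (dirDeriv (0, 1) h) 0 := by
  have := dirDeriv_comm hΩ hh (1, 0) (0, 1) h0
  rw [hessianMatrix, Matrix.det_fin_two_of]
  nth_rewrite 1 [this]
  rfl

theorem real_inner_eq_sum_inner (b : OrthonormalBasis (Fin 3) ℝ E3) (x y : E3) :
    inner ℝ x y = inner ℝ (b 0) x * inner ℝ (b 0) y + inner ℝ (b 1) x * inner ℝ (b 1) y
      + inner ℝ (b 2) x * inner ℝ (b 2) y := by
  rw [← b.sum_inner_mul_inner x y, Fin.sum_univ_three, real_inner_comm, real_inner_comm x (b 1),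
    real_inner_comm x (b 2)]

/-- Length-preserving smooth maps preserve the Hessian determinant in tangent-normal
coordinates. -/
theorem det_hessianMatrix_eq {S T : Set E3} {f : E3 → E3} {p : E3} (hST : Set.MapsTo f S T)
    (hsm : IsSmoothMapOn S f) (hlen : IsLengthPreservingOn S f) (hp : p ∈ S)
    {b b' : OrthonormalBasis (Fin 3) ℝ E3} {Ω Ω' : Set (ℝ × ℝ)} {h h' : ℝ × ℝ → ℝ}
    (H : IsTangentNormalAt S p b Ω h) (H' : IsTangentNormalAt T (f p) b' Ω' h') :
    (hessianMatrix h).det = (hessianMatrix h').det := by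
  have h0 := H.zero_mem hp
  have h0' := H'.zero_mem (hST hp)
  have hΩ := H.graph.1
  have hΩ' := H'.graph.1
  have hh := H.graph.2.1
  have hh' := H'.graph.2.1
  have hcrit := H.fderiv_eq_zero hp
  have hcrit' := H'.fderiv_eq_zero (hST hp)
  set s := graphMap p b h with hsdef
  have hs : ContDiffOn ℝ ∞ s Ω := contDiffOn_graphMap hh
  have hr : ContDiffOn ℝ ∞ (f ∘ s) Ω := hsm _ _ H.graph.isChart
  have hs0 : s 0 = p := by simpa using H.graph.graphMap_coordXY hp
  set r := f ∘ s with hrdef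
  have hr0 : r 0 = f p := by rw [hrdef, Function.comp_apply, hs0]
  have hrT : Set.MapsTo r Ω T := hST.comp H.graph.mapsTo
  have hmet : ∀ v w : ℝ × ℝ, ∀ q ∈ Ω, inner ℝ (dirDeriv v r q) (dirDeriv w r q)
      = inner ℝ (dirDeriv v s q) (dirDeriv w s q) := fun v w q hq =>
    inner_dirDeriv_eq_of_norm_eq
      (norm_dirDeriv_comp_eq hlen hΩ hs hr H.graph.mapsTo hq) v w
  -- the derivatives of the graph at the origin
  have hs1 : ∀ v, dirDeriv v s 0 = v.1 • b 0 + v.2 • b 1 := fun v => by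
    rw [hsdef, dirDeriv_graphMap (differentiableAt_of_contDiffOn hΩ hh h0)]
    simp [dirDeriv, hcrit]
  have hs2 : ∀ v w, dirDeriv v (dirDeriv w s) 0 = dirDeriv v (dirDeriv w h) 0 • b 2 :=
    fun v w => dirDeriv_dirDeriv_graphMap hΩ hh v w h0
  have hgauss := inner_sub_inner_eq_of_isometric hΩ hr hs hmet (1, 0) (0, 1) h0
  -- Transferred from `s`, whose second derivatives at 0 are multiples of `b 2` and whose first
  -- derivatives lie in the tangent plane.
  have hnormal : ∀ u v w, inner ℝ (dirDeriv u (dirDeriv v r) 0) (dirDeriv w r 0) = 0 := by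
    intro u v w
    rw [inner_dirDeriv_dirDeriv_eq_of_isometric hΩ hr hs hmet u v w h0, hs1, hs2]
    simp [inner_add_right, inner_smul_right, inner_smul_left]
  -- the image in the coordinates of the target
  obtain ⟨-, -, U, hUo, hpU, hU⟩ := H'.graph
  have hΩ₁ : IsOpen (Ω ∩ r ⁻¹' U) := hr.continuousOn.isOpen_inter_preimage hΩ hUo
  have h0₁ : (0 : ℝ × ℝ) ∈ Ω ∩ r ⁻¹' U := ⟨h0, by rw [Set.mem_preimage, hr0]; exact hpU⟩
  have hr₁ := hr.mono (Set.inter_subset_left (t := r ⁻¹' U))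
  set φ := coordXY (f p) b' ∘ r with hφdef
  have hφ : ContDiffOn ℝ ∞ φ (Ω ∩ r ⁻¹' U) := (contDiff_coordXY _ _).comp_contDiffOn hr₁
  have hφm : Set.MapsTo φ (Ω ∩ r ⁻¹' U) Ω' := fun q hq => (hU.subset ⟨hq.2, hrT hq.1⟩).1
  have hφ0 : φ 0 = 0 := by rw [hφdef, Function.comp_apply, hr0, coordXY_self]
  have hφ1 : ∀ v, dirDeriv v φ 0
      = (inner ℝ (b' 0) (dirDeriv v r 0), inner ℝ (b' 1) (dirDeriv v r 0)) := fun v => by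
    rw [dirDeriv, ((hasFDerivAt_coordXY (f p) b' (r 0)).comp 0
      (differentiableAt_of_contDiffOn hΩ hr h0).hasFDerivAt).fderiv]
    rfl
  have hZ : Set.EqOn (coordZ (f p) b' ∘ r) (h' ∘ φ) (Ω ∩ r ⁻¹' U) :=
    fun q hq => (hU.subset ⟨hq.2, hrT hq.1⟩).2
  have hZ1 : ∀ v, ∀ q ∈ Ω ∩ r ⁻¹' U,
      dirDeriv v (coordZ (f p) b' ∘ r) q = inner ℝ (b' 2) (dirDeriv v r q) := fun v q hq => by
    rw [dirDeriv, ((hasFDerivAt_coordZ (f p) b' (r q)).comp q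
      (differentiableAt_of_contDiffOn hΩ hr hq.1).hasFDerivAt).fderiv]
    rfl
  have htan : ∀ v, inner ℝ (b' 2) (dirDeriv v r 0) = 0 := fun v => by
    rw [← hZ1 v 0 h0₁, dirDeriv_congr hΩ₁ hZ v h0₁, dirDeriv,
      fderiv_comp 0 (differentiableAt_of_contDiffOn hΩ' hh' (hφm h0₁))
        (differentiableAt_of_contDiffOn hΩ₁ hφ h0₁), hφ0, hcrit']
    simp
  -- The z-coordinate of `r` is `h' ∘ φ` and `h'` is critical at 0, so its second derivatives are
  -- the pulled-back Hessian.
  have hZ2 : ∀ v w, inner ℝ (b' 2) (dirDeriv v (dirDeriv w r) 0)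
      = fderiv ℝ (fderiv ℝ h') 0 (dirDeriv v φ 0) (dirDeriv w φ 0) := fun v w => by
    have h1 := dirDeriv_dirDeriv_comp hΩ₁ hΩ' hh' hφ hφm h0₁ (by rw [hφ0, hcrit']) v w
    rw [hφ0] at h1
    rw [← h1, ← dirDeriv_congr hΩ₁ (dirDeriv_congr hΩ₁ hZ w) v h0₁,
      dirDeriv_congr hΩ₁ (hZ1 w) v h0₁]
    have h2 := (innerSL ℝ (b' 2)).hasFDerivAt.comp (0 : ℝ × ℝ)
      (differentiableAt_of_contDiffOn hΩ (contDiffOn_dirDeriv hΩ hr w) h0).hasFDerivAt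
    exact (congrArg (fun L => L v) h2.fderiv).symm
  -- linear algebra at the origin
  have hB : ∀ v w : ℝ × ℝ, fderiv ℝ (fderiv ℝ h') 0 v w
      = v.1 * w.1 * dirDeriv (1, 0) (dirDeriv (1, 0) h') 0
        + (v.1 * w.2 + v.2 * w.1) * dirDeriv (1, 0) (dirDeriv (0, 1) h') 0
        + v.2 * w.2 * dirDeriv (0, 1) (dirDeriv (0, 1) h') 0 := fun v w => by
    have hv : v = v.1 • ((1, 0) : ℝ × ℝ) + v.2 • ((0, 1) : ℝ × ℝ) := by ext <;> simp
    have hw : w = w.1 • ((1, 0) : ℝ × ℝ) + w.2 • ((0, 1) : ℝ × ℝ) := by ext <;> simp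
    conv_lhs => rw [hv, hw]
    simp only [map_add, map_smul, add_apply, smul_apply,
      ← dirDeriv_dirDeriv_eq hΩ' hh' _ _ h0', smul_eq_mul,
      dirDeriv_comm hΩ' hh' (0, 1) (1, 0) h0']
    ring
  have hm11 := hmet (1, 0) (1, 0) 0 h0
  have hm12 := hmet (1, 0) (0, 1) 0 h0
  have hm22 := hmet (0, 1) (0, 1) 0 h0
  simp only [hs1, real_inner_eq_sum_inner b' (dirDeriv _ r 0), htan] at hm11 hm12 hm22
  simp at hm11 hm12 hm22
  set a := inner ℝ (b' 0) (dirDeriv (1, 0) r 0)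
  set c := inner ℝ (b' 1) (dirDeriv (1, 0) r 0)
  set β := inner ℝ (b' 0) (dirDeriv (0, 1) r 0)
  set d := inner ℝ (b' 1) (dirDeriv (0, 1) r 0)
  -- Lagrange's identity: the squared determinant of dφ is the Gram determinant of an orthonormal
  -- pair.
  have hdet : (a * d - β * c) ^ 2 = 1 := by
    linear_combination (β * β + d * d) * hm11 + hm22 - (a * β + c * d) * hm12
  -- Orthogonality to both first derivatives is a 2 × 2 linear system with nonzero determinant;
  -- Cramer's rule gives zero.
  have hperp : ∀ u v, inner ℝ (b' 0) (dirDeriv u (dirDeriv v r) 0) = 0 ∧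
      inner ℝ (b' 1) (dirDeriv u (dirDeriv v r) 0) = 0 := by
    intro u v
    have h1 := hnormal u v (1, 0)
    have h2 := hnormal u v (0, 1)
    rw [real_inner_eq_sum_inner b', htan] at h1 h2
    set x := inner ℝ (b' 0) (dirDeriv u (dirDeriv v r) 0)
    set y := inner ℝ (b' 1) (dirDeriv u (dirDeriv v r) 0)
    have h1' : x * a + y * c = 0 := by linarith
    have h2' : x * β + y * d = 0 := by linarith
    constructor
    · linear_combination (-x) * hdet + (a * d - β * c) * (d * h1' - c * h2')
    · linear_combination (-y) * hdet + (a * d - β * c) * (a * h2' - β * h1')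
  rw [det_hessianMatrix hΩ hh h0, det_hessianMatrix hΩ' hh' h0']
  simp only [real_inner_eq_sum_inner b' (dirDeriv _ (dirDeriv _ r) 0), hZ2, hs2, hB, hφ1,
    (hperp _ _).1, (hperp _ _).2, real_inner_smul_left, real_inner_smul_right] at hgauss
  simp at hgauss
  set A := dirDeriv (1, 0) (dirDeriv (1, 0) h') 0
  set B := dirDeriv (1, 0) (dirDeriv (0, 1) h') 0
  set C := dirDeriv (0, 1) (dirDeriv (0, 1) h') 0
  -- The pulled-back Hessian has determinant (AC - B²)(ad - βc)².
  linear_combination (A * C - B * B) * hdet - hgauss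

/-! ### Principal curvatures and the Gauss curvature -/

theorem isHermitian_hessianMatrix {h : ℝ × ℝ → ℝ} {Ω : Set (ℝ × ℝ)} (hΩ : IsOpen Ω)
    (hh : ContDiffOn ℝ ∞ h Ω) (h0 : (0 : ℝ × ℝ) ∈ Ω) : (hessianMatrix h).IsHermitian := by
  have : partialX (partialY h) (0, 0) = partialY (partialX h) (0, 0) :=
    dirDeriv_comm hΩ hh (1, 0) (0, 1) h0
  ext i j
  fin_cases i <;> fin_cases j <;> simp [hessianMatrix, this]

theorem exists_charpoly_roots_eq_pair {A : Matrix (Fin 2) (Fin 2) ℝ} (hA : A.IsHermitian) :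
    ∃ k₁ k₂ : ℝ, k₁ ≤ k₂ ∧ A.charpoly.roots = {k₁, k₂} := by
  have h : A.charpoly.roots = {hA.eigenvalues 0, hA.eigenvalues 1} := by
    rw [hA.roots_charpoly_eq_eigenvalues]
    rfl
  rcases le_total (hA.eigenvalues 0) (hA.eigenvalues 1) with hle | hle
  · exact ⟨_, _, hle, h⟩
  · exact ⟨_, _, hle, h.trans (Multiset.pair_comm _ _)⟩

theorem mul_eq_det_of_charpoly_roots_eq_pair {A : Matrix (Fin 2) (Fin 2) ℝ} {k₁ k₂ : ℝ}
    (h : A.charpoly.roots = {k₁, k₂}) : k₁ * k₂ = A.det := by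
  rw [Matrix.det_eq_prod_roots_charpoly_of_splits
    (Polynomial.splits_iff_card_roots.2 (by rw [h]; simp [Matrix.charpoly_natDegree_eq_dim])), h]
  simp

/-- Allows two tangent-normal coordinate systems at one point to be compared by
`det_hessianMatrix_eq`. -/
theorem IsIntrinsicIsometry.refl (S : Set E3) : IsIntrinsicIsometry S S id where
  bijOn := Set.bijOn_id S
  smooth _ _ hs := hs.smooth
  lengthPreserving _ _ _ _ _ := rfl

/-- The Gauss curvature is the Hessian determinant in any tangent-normal coordinates. -/
theorem IsTangentNormalAt.hasGaussCurvatureAt {S : Set E3} {p : E3}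
    {b : OrthonormalBasis (Fin 3) ℝ E3} {Ω : Set (ℝ × ℝ)} {h : ℝ × ℝ → ℝ}
    (H : IsTangentNormalAt S p b Ω h) (hp : p ∈ S) :
    HasGaussCurvatureAt S p (hessianMatrix h).det := by
  constructor
  · obtain ⟨k₁, k₂, hle, hk⟩ := exists_charpoly_roots_eq_pair
      (isHermitian_hessianMatrix H.graph.1 H.graph.2.1 (H.zero_mem hp))
    exact ⟨k₁, k₂, hle, b, Ω, h, H, hk⟩
  · rintro k₁ k₂ ⟨-, b', Ω', h', H', hk⟩
    rw [mul_eq_det_of_charpoly_roots_eq_pair hk]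
    have hid := IsIntrinsicIsometry.refl S
    exact det_hessianMatrix_eq hid.bijOn.mapsTo hid.smooth hid.lengthPreserving hp H' H

end Egregium

theorem mainTheorem9 (S T : Set Egregium.E3) (f : Egregium.E3 → Egregium.E3) (p : Egregium.E3)
    (hS : Egregium.IsSmoothSurface S) (hT : Egregium.IsSmoothSurface T)
    (hf : Egregium.IsIntrinsicIsometry S T f) (hp : p ∈ S) :
    ∃ K : ℝ, Egregium.HasGaussCurvatureAt S p K ∧ Egregium.HasGaussCurvatureAt T (f p) K := by
  have hfp : f p ∈ T := hf.bijOn.mapsTo hp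
  obtain ⟨o, a, W, g, hg⟩ := hS.2 p hp
  obtain ⟨o', a', W', g', hg'⟩ := hT.2 (f p) hfp
  obtain ⟨b, Ω, h, H⟩ := hg.exists_isTangentNormalAt hp
  obtain ⟨b', Ω', h', H'⟩ := hg'.exists_isTangentNormalAt hfp
  refine ⟨_, H.hasGaussCurvatureAt hp, ?_⟩
  rw [Egregium.det_hessianMatrix_eq hf.bijOn.mapsTo hf.smooth hf.lengthPreserving hp H H']
  exact H'.hasGaussCurvatureAt hfp
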